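/- All Banach algebras are complex, associative, not necessarily unital, with submultiplicative norm. Let $\Omega$ be a locally compact Hausdorff space. A continuous field of Banach algebras $\mathcal{U}=\{\Omega,(A_t)_{t\in\Omega},\Theta\}$ over $\Omega$ consists of Banach algebras $A_t$ ($t\in\Omega$) and a subalgebra $\Theta$ of $\prod_{t\in\Omega}A_t$ such that (1) for every $t$ the set $\{x(t):x\in\Theta\}$ is dense in $A_t$; (2) $t\mapsto\|x(t)\|$ is continuous on $\Omega$ for every $x\in\Theta$; (3) if $x\in\prod_{t}A_t$ and for every $t\in\Omega$ and $\varepsilon>0$ there is $x'\in\Theta$ with $\|x(s)-x'(s)\|\le\varepsilon$ for all $s$ in some neighbourhood of $t$, then $x\in\Theta$. For $Y\subseteq\Omega$, a family $x\in\prod_{t\in Y}A_t$ is continuous on $Y$ if for every $t\in Y$ and $\varepsilon>0$ there is $x'\in\Theta$ with $\|x(s)-x'(s)\|\le\varepsilon$ for all $s\in Y$ in some neighbourhood of $t$. The field is locally trivial if every point of $\Omega$ has a neighbourhood $V$ for which there are a Banach algebra $B$ and isometric algebra isomorphisms $\varphi_t:A_t\to B$ ($t\in V$) such that $x\in\prod_{t\in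 V}A_t$ is continuous on $V$ if and only if $t\mapsto\varphi_t(x(t))$ is a continuous map $V\to B$. The Banach algebra $\mathfrak{A}$ defined by $\mathcal{U}$ consists of all $x\in\Theta$ such that $\|x(t)\|$ vanishes at infinity on $\Omega$, with pointwise operations and the norm $\|x\|=\sup_{t\in\Omega}\|x(t)\|$. For a Banach algebra $A$, let $A_+=A\oplus\mathbb{C}e$ be the algebra obtained by adjoining an identity to $A$, with $\|a+\lambda e\|=\|a\|+|\lambda|$. A Banach $A$-bimodule is a Banach space with bounded bilinear, associative and commuting left and right actions of $A$. A Banach $A$-bimodule $P$ is projective if every morphism of Banach $A$-bimodules $\varphi:Y\to P$ that has a right inverse among bounded linear maps has a right inverse among morphisms of Banach $A$-bimodules. The algebra $A$ is contractible if the Banach $A$-bimodule $A_+$ is projective. For a Banach $A$-bimodule $X$, $\mathcal{H}^n(A,X)$ denotes the $n$-th continuous Hochschild cohomology group, that is, the $n$-th cohomology of the complex of bounded $n$-linear maps $f:A^n\to X$ with $$(\delta^nf)(a_1,\dots,a_{n+1})=a_1\cdot f(a_2,\dots,a_{n+1})+\sum_{i=1}^n(-1)^if(a_1,\dots,a_ia_{i+1},\dots,a_{n+1})+(-1)^{n+1}f(a_1,\dots,a_n)\cdot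 a_{n+1}.$$ Theorem. Let $\Omega$ be a locally compact Hausdorff space, let $\mathcal{U}=\{\Omega,(A_x)_{x\in\Omega},\Theta\}$ be a locally trivial continuous field of non-zero Banach algebras, and let $\mathfrak{A}$ be the Banach algebra defined by $\mathcal{U}$. Then the following conditions are equivalent: (i) $\mathfrak{A}$ is contractible; (ii) $\Omega$ is finite and discrete, and all the Banach algebras $A_x$, $x\in\Omega$, are contractible; (iii) $\mathcal{H}^n(\mathfrak{A},X)=\{0\}$ for every Banach $\mathfrak{A}$-bimodule $X$ and all $n\ge1$. -/

import Mathlib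

open Filter Topology
open scoped ENNReal

universe u v w

namespace ContFieldAlg

/-! ## Banach bimodules, projectivity and contractibility -/

/-- The structure of a Banach `A`-bimodule on the Banach space `X`: jointly bounded bilinear left
and right actions `a · x = left a x` and `x · a = right a x` that are associative and commute with
each other. No unit is assumed to exist or to act as the identity. -/
structure BanachBimodule (A : Type u) [NonUnitalNormedRing A] [NormedSpace ℂ A]
    (X : Type v) [NormedAddCommGroup X] [NormedSpace ℂ X] where
  /-- `left a x = a · x` -/
  left : A →L[ℂ] X →L[ℂ] X
  /-- `right a x = x · a` -/
  right : A →L[ℂ] X →L[ℂ] X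
  left_mul : ∀ (a b : A) (x : X), left (a * b) x = left a (left b x)
  right_mul : ∀ (a b : A) (x : X), right (a * b) x = right b (right a x)
  left_right : ∀ (a b : A) (x : X), left a (right b x) = right b (left a x)

section Projective

variable {A : Type u} [NonUnitalNormedRing A] [NormedSpace ℂ A]

/-- A bounded linear map is a morphism of Banach `A`-bimodules. -/
def BanachBimodule.IsMorphism {X : Type v} [NormedAddCommGroup X] [NormedSpace ℂ X]
    {Y : Type w} [NormedAddCommGroup Y] [NormedSpace ℂ Y]
    (M : BanachBimodule A X) (N : BanachBimodule A Y) (f : X →L[ℂ] Y) : Prop :=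
  (∀ (a : A) (x : X), f (M.left a x) = N.left a (f x)) ∧
    ∀ (a : A) (x : X), f (M.right a x) = N.right a (f x)

/-- Projectivity of a Banach bimodule `P` in the category of Banach `A`-bimodules: every morphism
`φ : Y → P` that has a right inverse among bounded linear maps (such a `φ` is onto, in particular
an epimorphism) has a right inverse among bimodule morphisms. -/
def BanachBimodule.IsProjective {P : Type u} [NormedAddCommGroup P] [NormedSpace ℂ P]
    (M : BanachBimodule A P) : Prop :=
  ∀ (Y : Type u) [NormedAddCommGroup Y] [NormedSpace ℂ Y] [CompleteSpace Y]
    (N : BanachBimodule A Y) (φ : Y →L[ℂ] P), N.IsMorphism M φ →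
    (∃ σ : P →L[ℂ] Y, φ.comp σ = ContinuousLinearMap.id ℂ P) →
    ∃ ψ : P →L[ℂ] Y, M.IsMorphism N ψ ∧ φ.comp ψ = ContinuousLinearMap.id ℂ P

end Projective

section Unitization

variable (A : Type u) [NonUnitalNormedRing A] [NormedSpace ℂ A]

/-- The algebra `A₊ = A ⊕ ℂ e` obtained by adjoining an identity to `A` (whether or not `A` has
one), with the norm `‖a + λ e‖ = ‖a‖ + |λ|`. -/
abbrev Aplus : Type u := WithLp 1 (Unitization ℂ A)

variable [IsScalarTower ℂ A A] [SMulCommClass ℂ A A]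

/-- The inclusion `A → A₊`, `a ↦ a + 0 e`, as a bounded linear map. -/
noncomputable def inclPlus : A →L[ℂ] Aplus A :=
  LinearMap.mkContinuous
    (((WithLp.linearEquiv 1 ℂ (Unitization ℂ A)).symm : Unitization ℂ A →ₗ[ℂ] Aplus A).comp
      (Unitization.inrHom ℂ ℂ A)) 1
    (fun a => by
      rw [one_mul]
      exact (WithLp.unitization_norm_inr (𝕜 := ℂ) a).le)

variable {A} in
theorem inclPlus_apply (a : A) : inclPlus A a = WithLp.toLp 1 (a : Unitization ℂ A) := rfl

variable {A} in
theorem inclPlus_mul (a b : A) : inclPlus A (a * b) = inclPlus A a * inclPlus A b := by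
  apply (WithLp.equiv 1 (Unitization ℂ A)).injective
  exact Unitization.inr_mul ℂ a b

/-- `A₊` as a Banach `A`-bimodule under multiplication in `A₊`. -/
noncomputable def plusBimodule : BanachBimodule A (Aplus A) where
  left := (ContinuousLinearMap.mul ℂ (Aplus A)).comp (inclPlus A)
  right := (ContinuousLinearMap.mul ℂ (Aplus A)).flip.comp (inclPlus A)
  left_mul a b x := by simp [inclPlus_mul, mul_assoc]
  right_mul a b x := by simp [inclPlus_mul, mul_assoc]
  left_right a b x := by simp [mul_assoc]

theorem plusBimodule_left (a : A) (x : Aplus A) :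
    (plusBimodule A).left a x = inclPlus A a * x := rfl

theorem plusBimodule_right (a : A) (x : Aplus A) :
    (plusBimodule A).right a x = x * inclPlus A a := rfl

/-- A Banach algebra `A` is contractible if `A₊` is projective in the category of Banach
`A`-bimodules. -/
def IsContractible : Prop := (plusBimodule A).IsProjective

end Unitization

/-! ## Continuous Hochschild cohomology -/

section Hochschild

variable {A : Type u} [NonUnitalNormedRing A] [NormedSpace ℂ A]

section Merge

variable [IsScalarTower ℂ A A] [SMulCommClass ℂ A A]

theorem contractNth_update {n : ℕ} (j : Fin n) (g : Fin (n + 1) → A) (i : Fin (n + 1)) :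
    ∃ (k : Fin n) (L : A →ₗ[ℂ] A), ∀ x : A,
      Fin.contractNth j.castSucc (· * ·) (Function.update g i x) =
        Function.update (Fin.contractNth j.castSucc (· * ·) g) k (L x) := by
  rcases lt_trichotomy (i : ℕ) (j : ℕ) with h | h | h
  · refine ⟨⟨i, by omega⟩, LinearMap.id, fun x => funext fun k => ?_⟩
    simp only [Fin.contractNth, Function.update_apply, Fin.ext_iff, Fin.val_castSucc, Fin.val_succ,
      LinearMap.id_apply]
    grind
  · refine ⟨j, (LinearMap.mulRight ℂ (g j.succ) : A →ₗ[ℂ] A), fun x => funext fun k => ?_⟩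
    simp only [Fin.contractNth, Function.update_apply, Fin.ext_iff, Fin.val_castSucc, Fin.val_succ,
      LinearMap.mulRight_apply]
    grind
  · by_cases h' : (i : ℕ) = j + 1
    · refine ⟨j, (LinearMap.mulLeft ℂ (g j.castSucc) : A →ₗ[ℂ] A), fun x => funext fun k => ?_⟩
      simp only [Fin.contractNth, Function.update_apply, Fin.ext_iff, Fin.val_castSucc,
        Fin.val_succ, LinearMap.mulLeft_apply]
      grind
    · refine ⟨⟨i - 1, by omega⟩, LinearMap.id, fun x => funext fun k => ?_⟩
      simp only [Fin.contractNth, Function.update_apply, Fin.ext_iff, Fin.val_castSucc,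
        Fin.val_succ, LinearMap.id_apply]
      grind

variable {X : Type v} [NormedAddCommGroup X] [NormedSpace ℂ X]

/-- For a bounded `n`-linear `f` and `j < n` (counted from `0`), the bounded `(n+1)`-linear map
`(a₀, …, aₙ) ↦ f (a₀, …, aⱼ aⱼ₊₁, …, aₙ)`. -/
noncomputable def mergeTerm {n : ℕ} (f : ContinuousMultilinearMap ℂ (fun _ : Fin n => A) X)
    (j : Fin n) : ContinuousMultilinearMap ℂ (fun _ : Fin (n + 1) => A) X where
  toMultilinearMap := MultilinearMap.mk' (fun a => f (Fin.contractNth j.castSucc (· * ·) a))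
    (fun g i x y => by
      obtain ⟨k, L, h⟩ := contractNth_update j g i
      simp only [h, map_add, ContinuousMultilinearMap.map_update_add])
    (fun g i c x => by
      obtain ⟨k, L, h⟩ := contractNth_update j g i
      simp only [h, map_smul, ContinuousMultilinearMap.map_update_smul])
  cont := by
    refine f.cont.comp (continuous_pi fun k => ?_)
    simp only [Fin.contractNth]
    split_ifs <;> fun_prop

end Merge

variable [IsScalarTower ℂ A A] [SMulCommClass ℂ A A]
variable {X : Type v} [NormedAddCommGroup X] [NormedSpace ℂ X]

/-- The value of the Hochschild coboundary operator on a cochain. -/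
noncomputable def coboundaryFun (M : BanachBimodule A X) (n : ℕ)
    (f : ContinuousMultilinearMap ℂ (fun _ : Fin n => A) X) :
    ContinuousMultilinearMap ℂ (fun _ : Fin (n + 1) => A) X :=
  ContinuousLinearMap.uncurryLeft (Ei := fun _ : Fin (n + 1) => A)
      (((ContinuousLinearMap.compContinuousMultilinearMapL ℂ (fun _ : Fin n => A) X X).flip
        f).comp M.left)
    + ∑ j : Fin n, (-1 : ℂ) ^ ((j : ℕ) + 1) • mergeTerm f j
    + (-1 : ℂ) ^ (n + 1) • ContinuousMultilinearMap.uncurryRight (Ei := fun _ : Fin (n + 1) => A)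
        (M.right.flip.compContinuousMultilinearMap f)

/-- The formula
`(δⁿ f)(a₀, …, aₙ) = a₀ · f (a₁, …, aₙ) + ∑_{j < n} (-1)^(j+1) f (a₀, …, aⱼ aⱼ₊₁, …, aₙ)
  + (-1)^(n+1) f (a₀, …, aₙ₋₁) · aₙ`. -/
theorem coboundaryFun_apply (M : BanachBimodule A X) (n : ℕ)
    (f : ContinuousMultilinearMap ℂ (fun _ : Fin n => A) X) (a : Fin (n + 1) → A) :
    coboundaryFun M n f a =
      M.left (a 0) (f fun i => a i.succ)
        + ∑ j : Fin n, (-1 : ℂ) ^ ((j : ℕ) + 1) •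
            f (Fin.contractNth j.castSucc (· * ·) a)
        + (-1 : ℂ) ^ (n + 1) • M.right (a (Fin.last n)) (f fun i => a i.castSucc) := by
  simp only [coboundaryFun, _root_.add_apply, _root_.sum_apply,
    _root_.smul_apply]
  rfl

/-- The coboundary operator `δⁿ : Cⁿ(A, X) → Cⁿ⁺¹(A, X)` of the standard cohomological complex;
`Cⁿ(A, X)` is the space of bounded `n`-linear maps (for `n = 0` it is `X`). -/
noncomputable def coboundary (M : BanachBimodule A X) (n : ℕ) :
    ContinuousMultilinearMap ℂ (fun _ : Fin n => A) X →ₗ[ℂ]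
      ContinuousMultilinearMap ℂ (fun _ : Fin (n + 1) => A) X where
  toFun := coboundaryFun M n
  map_add' f g := by
    ext a
    simp only [coboundaryFun_apply, _root_.add_apply, map_add, smul_add,
      Finset.sum_add_distrib]
    abel
  map_smul' c f := by
    ext a
    simp only [coboundaryFun_apply, _root_.smul_apply, map_smul, smul_add,
      Finset.smul_sum, RingHom.id_apply]
    simp only [smul_comm c]

/-- The space of `n`-coboundaries: the range of `δⁿ⁻¹`, and `0` for `n = 0`. -/
noncomputable def coboundaries (M : BanachBimodule A X) :
    (n : ℕ) → Submodule ℂ (ContinuousMultilinearMap ℂ (fun _ : Fin n => A) X)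
  | 0 => ⊥
  | n + 1 => LinearMap.range (coboundary M n)

/-- The continuous Hochschild cohomology group `Hⁿ(A, X) = ker δⁿ / im δⁿ⁻¹`. -/
abbrev HochschildCohomology (M : BanachBimodule A X) (n : ℕ) : Type (max u v) :=
  LinearMap.ker (coboundary M n) ⧸
    (coboundaries M n).comap (LinearMap.ker (coboundary M n)).subtype

end Hochschild

/-! ## Continuous fields of Banach algebras -/

/-- A continuous field of Banach algebras over `Ω` with fibres `A t`, given by its algebra `Θ` of
continuous vector fields. -/
structure ContinuousField (Ω : Type u) [TopologicalSpace Ω] (A : Ω → Type v)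
    [∀ t, NonUnitalNormedRing (A t)] [∀ t, NormedSpace ℂ (A t)] where
  /-- the continuous vector fields -/
  Θ : NonUnitalSubalgebra ℂ (∀ t, A t)
  dense_eval : ∀ t : Ω, Dense {a : A t | ∃ x ∈ Θ, x t = a}
  continuous_norm : ∀ x ∈ Θ, Continuous fun t => ‖x t‖
  mem_of_locally_approx : ∀ x : ∀ t, A t,
    (∀ t : Ω, ∀ ε : ℝ, 0 < ε → ∃ x' ∈ Θ, ∀ᶠ s in 𝓝 t, ‖x s - x' s‖ ≤ ε) → x ∈ Θ

namespace ContinuousField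

variable {Ω : Type u} [TopologicalSpace Ω] {A : Ω → Type v}
  [∀ t, NonUnitalNormedRing (A t)] [∀ t, NormedSpace ℂ (A t)]

/-- A vector field `x` over `Y ⊆ Ω` is continuous on `Y`: near every point of `Y` (in the relative
topology of `Y`) it is uniformly approximated by elements of `Θ`. These fields are the continuous
vector fields of the induced field on `Y`. -/
def IsContinuousOver (𝒰 : ContinuousField Ω A) (Y : Set Ω) (x : ∀ t : Y, A t) : Prop :=
  ∀ t : Y, ∀ ε : ℝ, 0 < ε → ∃ x' ∈ 𝒰.Θ, ∀ᶠ s : Y in 𝓝 t, ‖x s - x' s‖ ≤ ε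

/-- The induced field on `Y` is trivial: there are a Banach algebra `B` and isometric isomorphisms
of Banach algebras `φ t : A t → B`, `t ∈ Y`, that carry the continuous vector fields over `Y`
exactly onto the continuous maps `Y → B`. -/
def IsTrivialOver (𝒰 : ContinuousField Ω A) (Y : Set Ω) : Prop :=
  ∃ (B : Type v) (_ : NonUnitalNormedRing B) (_ : NormedSpace ℂ B)
    (_ : IsScalarTower ℂ B B) (_ : SMulCommClass ℂ B B) (_ : CompleteSpace B)
    (φ : ∀ t : Y, A t ≃ₗᵢ[ℂ] B),
    (∀ (t : Y) (a b : A t), φ t (a * b) = φ t a * φ t b) ∧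
    ∀ x : ∀ t : Y, A t, 𝒰.IsContinuousOver Y x ↔ Continuous fun t : Y => φ t (x t)

/-- Every point of `Ω` has a neighbourhood over which the field is trivial. -/
def IsLocallyTrivial (𝒰 : ContinuousField Ω A) : Prop :=
  ∀ t : Ω, ∃ V ∈ 𝓝 t, 𝒰.IsTrivialOver V

theorem bounded_of_vanishing (𝒰 : ContinuousField Ω A) {x : ∀ t, A t} (hx : x ∈ 𝒰.Θ)
    (h0 : Tendsto (fun t => ‖x t‖) (cocompact Ω) (𝓝 0)) : Memℓp x ∞ := by
  obtain ⟨K, hK, hKs⟩ := mem_cocompact.1 (h0.eventually (gt_mem_nhds one_pos))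
  obtain ⟨C, hC⟩ := hK.bddAbove_image (𝒰.continuous_norm x hx).continuousOn
  refine memℓp_infty ⟨max C 1, ?_⟩
  rintro _ ⟨t, rfl⟩
  by_cases ht : t ∈ K
  · exact (hC ⟨t, ht, rfl⟩).trans (le_max_left _ _)
  · exact (le_of_lt (hKs ht)).trans (le_max_right _ _)

/-- The Banach algebra defined by the field: all `x ∈ Θ` such that `‖x t‖` vanishes at infinity on
`Ω`, with pointwise operations and the norm `‖x‖ = sup_t ‖x t‖`. It is carved out of the Banach
algebra of all bounded vector fields with the supremum norm; nothing is lost thereby, as the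
elements in question are bounded. -/
def sectionAlgebra (𝒰 : ContinuousField Ω A) : NonUnitalSubalgebra ℂ (lp A ∞) where
  carrier := {x | (⇑x : ∀ t, A t) ∈ 𝒰.Θ ∧ Tendsto (fun t => ‖x t‖) (cocompact Ω) (𝓝 0)}
  zero_mem' := ⟨𝒰.Θ.zero_mem, by simp [tendsto_const_nhds]⟩
  add_mem' := by
    rintro x y ⟨hx, hx0⟩ ⟨hy, hy0⟩
    refine ⟨𝒰.Θ.add_mem hx hy, ?_⟩
    exact squeeze_zero (fun _ => norm_nonneg _) (fun t => norm_add_le (x t) (y t))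
      (by simpa using hx0.add hy0)
  mul_mem' := by
    rintro x y ⟨hx, hx0⟩ ⟨hy, hy0⟩
    refine ⟨𝒰.Θ.mul_mem hx hy, ?_⟩
    exact squeeze_zero (fun _ => norm_nonneg _) (fun t => norm_mul_le (x t) (y t))
      (by simpa using hx0.mul hy0)
  smul_mem' := by
    rintro c x ⟨hx, hx0⟩
    refine ⟨𝒰.Θ.smul_mem' c hx, ?_⟩
    exact squeeze_zero (fun _ => norm_nonneg _) (fun t => norm_smul_le c (x t))
      (by simpa using hx0.const_mul ‖c‖)

theorem mem_sectionAlgebra (𝒰 : ContinuousField Ω A) (x : lp A ∞) :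
    x ∈ 𝒰.sectionAlgebra ↔
      (⇑x : ∀ t, A t) ∈ 𝒰.Θ ∧ Tendsto (fun t => ‖x t‖) (cocompact Ω) (𝓝 0) := Iff.rfl

/-- Every `x ∈ Θ` vanishing at infinity is (the underlying vector field of) an element of the
section algebra. -/
theorem exists_section (𝒰 : ContinuousField Ω A) {x : ∀ t, A t} (hx : x ∈ 𝒰.Θ)
    (h0 : Tendsto (fun t => ‖x t‖) (cocompact Ω) (𝓝 0)) :
    ∃ a : 𝒰.sectionAlgebra, ∀ t, (a : lp A ∞) t = x t :=
  ⟨⟨⟨x, 𝒰.bounded_of_vanishing hx h0⟩, hx, h0⟩, fun _ => rfl⟩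

theorem norm_section (𝒰 : ContinuousField Ω A) (a : 𝒰.sectionAlgebra) :
    ‖a‖ = ⨆ t, ‖(a : lp A ∞) t‖ :=
  lp.norm_eq_ciSup (a : lp A ∞)

noncomputable instance normedSpace_sectionAlgebra (𝒰 : ContinuousField Ω A) :
    NormedSpace ℂ 𝒰.sectionAlgebra where
  norm_smul_le c a := norm_smul_le c (a : lp A ∞)

/-- The section algebra is complete, hence a Banach algebra. -/
instance completeSpace_sectionAlgebra [∀ t, CompleteSpace (A t)] (𝒰 : ContinuousField Ω A) :
    CompleteSpace 𝒰.sectionAlgebra := by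
  have hclosed : IsClosed (𝒰.sectionAlgebra : Set (lp A ∞)) := by
    refine isClosed_of_closure_subset fun x hx => ?_
    have happ : ∀ ε : ℝ, 0 < ε → ∃ y ∈ 𝒰.sectionAlgebra, ∀ t, ‖x t - y t‖ < ε := by
      intro ε hε
      obtain ⟨y, hy, hxy⟩ := Metric.mem_closure_iff.1 hx ε hε
      refine ⟨y, hy, fun t => lt_of_le_of_lt ?_ (dist_eq_norm x y ▸ hxy)⟩
      exact lp.norm_apply_le_norm ENNReal.top_ne_zero (x - y) t
    refine ⟨𝒰.mem_of_locally_approx _ fun t ε hε => ?_, ?_⟩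
    · obtain ⟨y, hy, h⟩ := happ ε hε
      exact ⟨_, hy.1, Eventually.of_forall fun s => (h s).le⟩
    · refine Metric.tendsto_nhds.2 fun ε hε => ?_
      obtain ⟨y, hy, h⟩ := happ (ε / 2) (half_pos hε)
      filter_upwards [Metric.tendsto_nhds.1 hy.2 (ε / 2) (half_pos hε)] with t ht
      have h1 := norm_le_norm_add_norm_sub' (x t) (y t)
      have h2 := h t
      simp only [dist_zero_right, norm_norm] at ht ⊢
      linarith
  exact hclosed.completeSpace_coe

end ContinuousField

end ContFieldAlg

/-! Splitting `A₊` off a suitable extension shows that an algebra is contractible if and only if all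
its bounded derivations into Banach bimodules are inner, that is, `H¹` vanishes; the higher groups
then vanish by dimension shifting.

Suppose this holds for the section algebra. It then has a unit, whose norm at every point is at
least `1`, so `Ω` is compact. If the field embeds over a neighbourhood `V` of `t₀` into a trivial
field with fibre `B`, the homomorphisms `a ↦ φ ∘ a` and `a ↦ φ (a t₀)` into the bounded continuous
functions `V → B` agree at `t₀`. Their difference is therefore a derivation vanishing at `t₀`, and
it is implemented by a function `z` with `z t₀ = 0`. Sections vanishing at `t₀` but not at `s` force
`1 ≤ ‖z s‖` for `s ≠ t₀`, so `t₀` is isolated by continuity of `z`. The fibres inherit the property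
because evaluation has dense range. Conversely, a section algebra over a finite discrete space is
a direct sum of the fibres, and implementing elements can be glued.
-/

namespace ContFieldAlg

section Derivation

variable {A : Type u} [NonUnitalNormedRing A] [NormedSpace ℂ A]

namespace BanachBimodule

variable {X : Type v} [NormedAddCommGroup X] [NormedSpace ℂ X]

/-- A bounded derivation of `A` into a Banach `A`-bimodule. -/
def IsDerivation (M : BanachBimodule A X) (D : A →L[ℂ] X) : Prop :=
  ∀ a b, D (a * b) = M.left a (D b) + M.right b (D a)

/-- The inner derivation `a ↦ a · z - z · a` implemented by `z`. -/
noncomputable def innerDerivation (M : BanachBimodule A X) (z : X) : A →L[ℂ] X :=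
  M.left.flip z - M.right.flip z

theorem innerDerivation_apply (M : BanachBimodule A X) (z : X) (a : A) :
    M.innerDerivation z a = M.left a z - M.right a z := rfl

theorem isDerivation_innerDerivation (M : BanachBimodule A X) (z : X) :
    M.IsDerivation (M.innerDerivation z) := fun a b => by
  simp only [innerDerivation_apply, map_sub, M.left_mul, M.right_mul, M.left_right]
  abel

/-- Restriction of the actions along a bounded homomorphism `π : A → B`. -/
noncomputable def pullback {B : Type w} [NonUnitalNormedRing B] [NormedSpace ℂ B]
    (M : BanachBimodule B X) (π : A →L[ℂ] B) (hπ : ∀ a b, π (a * b) = π a * π b) :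
    BanachBimodule A X where
  left := M.left.comp π
  right := M.right.comp π
  left_mul a b x := by simp [hπ, M.left_mul]
  right_mul a b x := by simp [hπ, M.right_mul]
  left_right a b x := by simp [M.left_right]

theorem IsDerivation.comp {B : Type w} [NonUnitalNormedRing B] [NormedSpace ℂ B]
    {M : BanachBimodule B X} {D : B →L[ℂ] X} (hD : M.IsDerivation D) (π : A →L[ℂ] B)
    (hπ : ∀ a b, π (a * b) = π a * π b) : (M.pullback π hπ).IsDerivation (D.comp π) :=
  fun a b => by simp [pullback, hπ, hD _ _]

theorem IsDerivation.left_right_eq_of_mul_eq_zero {M : BanachBimodule A X} {D : A →L[ℂ] X}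
    (hD : M.IsDerivation D) {a b : A} (hab : a * b = 0) {x y : X}
    (hx : D a = M.innerDerivation x a) (hy : D b = M.innerDerivation y b) :
    M.left a (M.right b x) = M.left a (M.right b y) := by
  have hD0 : D (a * b) = M.left a (M.right b x) - M.left a (M.right b y) := by
    rw [hD, hx, hy, innerDerivation_apply, innerDerivation_apply, map_sub, map_sub, ← M.left_mul,
      ← M.right_mul, ← M.left_right, hab, map_zero, map_zero, zero_apply, zero_apply]
    abel
  rwa [hab, map_zero, eq_comm, sub_eq_zero] at hD0

end BanachBimodule

variable (A) in
/-- Every bounded derivation of `A` into a Banach `A`-bimodule is inner. The coefficients range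
over the universe `w`; `DerivationsAreInner.lift_universe` shows that its choice is immaterial. -/
def DerivationsAreInner : Prop :=
  ∀ (X : Type w) [NormedAddCommGroup X] [NormedSpace ℂ X] [CompleteSpace X]
    (M : BanachBimodule A X) (D : A →L[ℂ] X), M.IsDerivation D → ∃ z, M.innerDerivation z = D

theorem DerivationsAreInner.of_denseRange {B : Type v} [NonUnitalNormedRing B] [NormedSpace ℂ B]
    (h : DerivationsAreInner.{u, w} A) (π : A →L[ℂ] B) (hπ : ∀ a b, π (a * b) = π a * π b)
    (hd : DenseRange π) : DerivationsAreInner.{v, w} B := by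
  intro X _ _ _ M D hD
  obtain ⟨z, hz⟩ := h X (M.pullback π hπ) (D.comp π) (hD.comp π hπ)
  exact ⟨z, DFunLike.coe_injective <|
    hd.equalizer (M.innerDerivation z).continuous D.continuous (congrArg DFunLike.coe hz)⟩

end Derivation

section Subbimodule

variable {A : Type u} [NonUnitalNormedRing A] [NormedSpace ℂ A]
  {X : Type v} [NormedAddCommGroup X] [NormedSpace ℂ X]
  {X' : Type w} [NormedAddCommGroup X'] [NormedSpace ℂ X']

theorem exists_isometry_comp_eq {E : Type*} [NormedAddCommGroup E] [NormedSpace ℂ E]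
    (J : X' →ₗᵢ[ℂ] X) (T : E →L[ℂ] X) (h : ∀ a, T a ∈ LinearMap.range J.toLinearMap) :
    ∃ T' : E →L[ℂ] X', ∀ a, J (T' a) = T a :=
  ⟨J.equivRange.symm.toContinuousLinearEquiv.toContinuousLinearMap.comp (T.codRestrict _ h),
    fun a => congrArg Subtype.val (J.equivRange.apply_symm_apply ⟨T a, h a⟩)⟩

theorem exists_isometry_comp_eq_comp {E : Type*} [NormedAddCommGroup E] [NormedSpace ℂ E]
    (J : X' →ₗᵢ[ℂ] X) (T : E →L[ℂ] X →L[ℂ] X)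
    (h : ∀ a x, T a (J x) ∈ LinearMap.range J.toLinearMap) :
    ∃ T' : E →L[ℂ] X' →L[ℂ] X', ∀ a x, J (T' a x) = T a (J x) := by
  obtain ⟨T', hT'⟩ := exists_isometry_comp_eq (J.postcomp (σ₁₂ := RingHom.id ℂ) (E := X'))
    (((ContinuousLinearMap.compL ℂ X' X X).flip J.toContinuousLinearMap).comp T) fun a => by
      obtain ⟨S, hS⟩ := exists_isometry_comp_eq J ((T a).comp J.toContinuousLinearMap) (h a)
      exact ⟨S, ContinuousLinearMap.ext hS⟩
  exact ⟨T', fun a x => DFunLike.congr_fun (hT' a) x⟩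

namespace BanachBimodule

/-- A linear subspace invariant under both actions. -/
def IsSubbimodule (M : BanachBimodule A X) (N : Submodule ℂ X) : Prop :=
  (∀ a, ∀ x ∈ N, M.left a x ∈ N) ∧ ∀ a, ∀ x ∈ N, M.right a x ∈ N

theorem IsSubbimodule.topologicalClosure {M : BanachBimodule A X} {N : Submodule ℂ X}
    (hN : M.IsSubbimodule N) : M.IsSubbimodule N.topologicalClosure :=
  ⟨fun a _ hx => map_mem_closure (M.left a).continuous hx (hN.1 a),
    fun a _ hx => map_mem_closure (M.right a).continuous hx (hN.2 a)⟩

theorem IsMorphism.isSubbimodule_ker {M : BanachBimodule A X} {M' : BanachBimodule A X'}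
    {φ : X →L[ℂ] X'} (hφ : M.IsMorphism M' φ) :
    M.IsSubbimodule (LinearMap.ker φ.toLinearMap) := by
  constructor <;> intro a x hx <;>
    simp_all only [LinearMap.mem_ker, ContinuousLinearMap.coe_coe, hφ.1, hφ.2, map_zero]

theorem exists_isMorphism_of_isSubbimodule_range (M : BanachBimodule A X) (J : X' →ₗᵢ[ℂ] X)
    (hJ : M.IsSubbimodule (LinearMap.range J.toLinearMap)) :
    ∃ M' : BanachBimodule A X', M'.IsMorphism M J.toContinuousLinearMap := by
  obtain ⟨l, hl⟩ := exists_isometry_comp_eq_comp J M.left fun a x => hJ.1 a _ ⟨x, rfl⟩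
  obtain ⟨r, hr⟩ := exists_isometry_comp_eq_comp J M.right fun a x => hJ.2 a _ ⟨x, rfl⟩
  exact ⟨⟨l, r, fun a b x => J.injective (by simp [hl, M.left_mul]),
    fun a b x => J.injective (by simp [hr, M.right_mul]),
    fun a b x => J.injective (by simp [hl, hr, M.left_right])⟩, hl, hr⟩

end BanachBimodule

theorem DerivationsAreInner.exists_mem_range [CompleteSpace X']
    (h : DerivationsAreInner.{u, w} A) {M : BanachBimodule A X} (J : X' →ₗᵢ[ℂ] X)
    (hJ : M.IsSubbimodule (LinearMap.range J.toLinearMap)) {D : A →L[ℂ] X}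
    (hD : M.IsDerivation D) (hDJ : ∀ a, D a ∈ LinearMap.range J.toLinearMap) :
    ∃ z ∈ LinearMap.range J.toLinearMap, M.innerDerivation z = D := by
  obtain ⟨M', hl, hr⟩ := M.exists_isMorphism_of_isSubbimodule_range J hJ
  obtain ⟨D', hD'⟩ := exists_isometry_comp_eq J D hDJ
  simp only [LinearIsometry.coe_toContinuousLinearMap] at hl hr
  obtain ⟨z, hz⟩ := h X' M' D' fun a b => J.injective <| by
    simp only [map_add, hD', hD a b, hl, hr]
  refine ⟨J z, ⟨z, rfl⟩, ContinuousLinearMap.ext fun a => ?_⟩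
  rw [← hD', ← hz]
  simp only [BanachBimodule.innerDerivation_apply, map_sub, hl, hr]

theorem DerivationsAreInner.exists_mem [CompleteSpace X] (h : DerivationsAreInner.{u, w} A)
    {M : BanachBimodule A X} {N : Submodule ℂ X} [Small.{w} N] (hNc : IsClosed (N : Set X))
    (hN : M.IsSubbimodule N) {D : A →L[ℂ] X} (hD : M.IsDerivation D) (hDN : ∀ a, D a ∈ N) :
    ∃ z ∈ N, M.innerDerivation z = D := by
  have : CompleteSpace N := hNc.completeSpace_coe
  let e : Shrink.{w} N ≃ₗᵢ[ℂ] N := { Shrink.linearEquiv ℂ N with norm_map' := fun _ => rfl }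
  have : CompleteSpace (Shrink.{w} N) := e.toIsometryEquiv.completeSpace
  let J : Shrink.{w} N →ₗᵢ[ℂ] X := N.subtypeₗᵢ.comp e.toLinearIsometry
  have hJ : LinearMap.range J.toLinearMap = N :=
    SetLike.coe_injective ((e.surjective.range_comp Subtype.val).trans Subtype.range_val)
  obtain ⟨z, hz, hzD⟩ := h.exists_mem_range J (hJ.symm ▸ hN) hD (hJ.symm ▸ hDN)
  exact ⟨z, hJ ▸ hz, hzD⟩

theorem DerivationsAreInner.exists_mem_ker [CompleteSpace X] (h : DerivationsAreInner.{u, v} A)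
    {M : BanachBimodule A X} {M' : BanachBimodule A X'} {φ : X →L[ℂ] X'}
    (hφ : M.IsMorphism M' φ) {D : A →L[ℂ] X} (hD : M.IsDerivation D) (hφD : φ.comp D = 0) :
    ∃ z, φ z = 0 ∧ M.innerDerivation z = D :=
  h.exists_mem φ.isClosed_ker hφ.isSubbimodule_ker hD fun a => DFunLike.congr_fun hφD a

end Subbimodule

section Universe

variable {A : Type u} [NonUnitalNormedRing A] [NormedSpace ℂ A]
  {X : Type v} [NormedAddCommGroup X] [NormedSpace ℂ X]

theorem small_closure {Y : Type v} [TopologicalSpace Y] [T2Space Y] [FrechetUrysohnSpace Y]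
    (s : Set Y) [Small.{w} s] : Small.{w} (closure s) := by
  rcases isEmpty_or_nonempty Y with _ | _
  · infer_instance
  let lim (f : ℕ → s) : Y := limUnder atTop fun n => (f n : Y)
  have : Small.{w} (ℕ → s) := small_map ((Equiv.refl ℕ).arrowCongr (equivShrink.{w} s))
  have : Small.{w} (Set.range lim) := small_range lim
  refine small_subset (s := Set.range lim) fun x hx => ?_
  obtain ⟨f, hf, hfx⟩ := mem_closure_iff_seq_limit.1 hx
  exact ⟨fun n => ⟨f n, hf n⟩, hfx.limUnder_eq⟩

namespace BanachBimodule

/-- The span of the elements `D a` and `a · D b`, which for a derivation `D` is the sub-bimodule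
generated by the values of `D`. -/
def derivationSpan (M : BanachBimodule A X) (D : A →L[ℂ] X) : Submodule ℂ X :=
  Submodule.span ℂ (Set.range D ∪ Set.range fun p : A × A => M.left p.1 (D p.2))

theorem apply_mem_derivationSpan (M : BanachBimodule A X) (D : A →L[ℂ] X) (a : A) :
    D a ∈ M.derivationSpan D :=
  Submodule.subset_span (Or.inl ⟨a, rfl⟩)

theorem left_apply_mem_derivationSpan (M : BanachBimodule A X) (D : A →L[ℂ] X) (a b : A) :
    M.left a (D b) ∈ M.derivationSpan D :=
  Submodule.subset_span (Or.inr ⟨(a, b), rfl⟩)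

theorem IsDerivation.isSubbimodule_derivationSpan {M : BanachBimodule A X} {D : A →L[ℂ] X}
    (hD : M.IsDerivation D) : M.IsSubbimodule (M.derivationSpan D) := by
  have right_apply (a b : A) : M.right a (D b) = D (b * a) - M.left b (D a) := by
    rw [hD]; abel
  have hl (a : A) : M.derivationSpan D ≤ (M.derivationSpan D).comap (M.left a).toLinearMap := by
    refine Submodule.span_le.2 ?_
    rintro _ (⟨b, rfl⟩ | ⟨⟨b, c⟩, rfl⟩) <;>
      simp only [SetLike.mem_coe, Submodule.mem_comap, ContinuousLinearMap.coe_coe, ← M.left_mul,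
        left_apply_mem_derivationSpan]
  have hr (a : A) : M.derivationSpan D ≤ (M.derivationSpan D).comap (M.right a).toLinearMap := by
    refine Submodule.span_le.2 ?_
    rintro _ (⟨b, rfl⟩ | ⟨⟨b, c⟩, rfl⟩) <;>
      simp only [SetLike.mem_coe, Submodule.mem_comap, ContinuousLinearMap.coe_coe,
        ← M.left_right, right_apply, map_sub, ← M.left_mul, sub_mem,
        apply_mem_derivationSpan, left_apply_mem_derivationSpan]
  exact ⟨fun a _ hx => hl a hx, fun a _ hx => hr a hx⟩

end BanachBimodule

/-- A derivation takes its values in a closed sub-bimodule that is no larger than the algebra. -/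
theorem DerivationsAreInner.lift_universe (h : DerivationsAreInner.{u, u} A) :
    DerivationsAreInner.{u, w} A := by
  intro X _ _ _ M D hD
  let S := M.derivationSpan D
  have : Small.{u} S := Submodule.small_span _
  have : Small.{u} S.topologicalClosure := small_closure (S : Set X)
  obtain ⟨z, -, hz⟩ := h.exists_mem S.isClosed_topologicalClosure
    hD.isSubbimodule_derivationSpan.topologicalClosure hD
    fun a => S.le_topologicalClosure (M.apply_mem_derivationSpan D a)
  exact ⟨z, hz⟩

end Universe

section Homomorphisms

variable {A : Type u} [NonUnitalNormedRing A] [NormedSpace ℂ A]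
  {C : Type v} [NonUnitalNormedRing C] [NormedSpace ℂ C] [IsScalarTower ℂ C C]
  [SMulCommClass ℂ C C]

/-- The bimodule `C` with actions `a · x = p a * x` and `x · a = x * q a` along two bounded
homomorphisms `p, q : A → C`. -/
noncomputable def BanachBimodule.ofHoms (p q : A →L[ℂ] C) (hp : ∀ a b, p (a * b) = p a * p b)
    (hq : ∀ a b, q (a * b) = q a * q b) : BanachBimodule A C where
  left := (ContinuousLinearMap.mul ℂ C).comp p
  right := (ContinuousLinearMap.mul ℂ C).flip.comp q
  left_mul := by simp [hp, mul_assoc]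
  right_mul := by simp [hq, mul_assoc]
  left_right := by simp [mul_assoc]

theorem BanachBimodule.isDerivation_ofHoms_sub (p q : A →L[ℂ] C)
    (hp : ∀ a b, p (a * b) = p a * p b) (hq : ∀ a b, q (a * b) = q a * q b) :
    (ofHoms p q hp hq).IsDerivation (p - q) := fun a b => by
  simp [ofHoms, hp, hq, mul_sub]

/-- If `C` has a unit, then `1 - z` intertwines `p` and `q`. -/
theorem DerivationsAreInner.exists_intertwiner [CompleteSpace C]
    (h : DerivationsAreInner.{u, v} A) {p q : A →L[ℂ] C} (hp : ∀ a b, p (a * b) = p a * p b)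
    (hq : ∀ a b, q (a * b) = q a * q b) {E : Type w} [NonUnitalNormedRing E] [NormedSpace ℂ E]
    [IsScalarTower ℂ E E] [SMulCommClass ℂ E E] {ρ : C →L[ℂ] E}
    (hρ : ∀ x y, ρ (x * y) = ρ x * ρ y) (hpq : ρ.comp p = ρ.comp q) :
    ∃ z, ρ z = 0 ∧ ∀ a, p a - q a = p a * z - z * q a := by
  have hφ : (BanachBimodule.ofHoms p q hp hq).IsMorphism
      (.ofHoms (ρ.comp p) (ρ.comp q) (by simp [hp, hρ]) (by simp [hq, hρ])) ρ :=
    ⟨fun _ _ => hρ _ _, fun _ _ => hρ _ _⟩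
  obtain ⟨z, hz, hpqz⟩ := h.exists_mem_ker hφ (BanachBimodule.isDerivation_ofHoms_sub p q hp hq)
    (by rw [ContinuousLinearMap.comp_sub, hpq, sub_self])
  exact ⟨z, hz, fun a => (DFunLike.congr_fun hpqz a).symm⟩

/-- Both one-sided units come from comparing the identity of `A` with the zero homomorphism. -/
theorem DerivationsAreInner.exists_unit [IsScalarTower ℂ A A] [SMulCommClass ℂ A A]
    [CompleteSpace A] (h : DerivationsAreInner.{u, u} A) : ∃ e : A, ∀ a, e * a = a ∧ a * e = a := by
  have hid (a b : A) : ContinuousLinearMap.id ℂ A (a * b) = a * b := rfl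
  have hzero (a b : A) : (0 : A →L[ℂ] A) (a * b) = 0 * 0 := by simp
  obtain ⟨e, -, he⟩ := h.exists_intertwiner hzero hid (ρ := (0 : A →L[ℂ] A)) (by simp) (by simp)
  obtain ⟨e', -, he'⟩ := h.exists_intertwiner hid hzero (ρ := (0 : A →L[ℂ] A)) (by simp) (by simp)
  have left_unit (a : A) : e * a = a := by simpa using (he a).symm
  have right_unit (a : A) : a * e' = a := by simpa using (he' a).symm
  have hee' : e = e' := (right_unit e).symm.trans (left_unit e')
  exact ⟨e, fun a => ⟨left_unit a, hee' ▸ right_unit a⟩⟩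

end Homomorphisms

section DirectSum

variable {A : Type u} [NonUnitalNormedRing A] [NormedSpace ℂ A]

/-- Implementing elements `z k` on the summands are glued by the Peirce-type formula
`z = ∑ e k · z k + (1 - E) · ∑ z k · e k`, where `E = ∑ e k`. The bimodule need not be unital, so
the second term does not vanish in general. -/
theorem DerivationsAreInner.of_finite_sum {ι : Type*} [Fintype ι] {B : ι → Type v}
    [∀ i, NonUnitalNormedRing (B i)] [∀ i, NormedSpace ℂ (B i)]
    (h : ∀ i, DerivationsAreInner.{v, w} (B i)) (hunit : ∀ i, ∃ e : B i, ∀ b, e * b = b ∧ b * e = b)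
    (j : ∀ i, B i →L[ℂ] A) (hj : ∀ i a b, j i (a * b) = j i a * j i b)
    (hjk : ∀ i k, i ≠ k → ∀ a b, j i a * j k b = 0)
    (hsum : ∀ a, ∃ b : ∀ i, B i, a = ∑ i, j i (b i)) : DerivationsAreInner.{u, w} A := by
  intro X _ _ _ M D hD
  choose u hu using hunit
  choose z hz using fun i => h i X (M.pullback (j i) (hj i)) (D.comp (j i)) (hD.comp (j i) (hj i))
  let e k := j k (u k)
  have hDj (i) (b : B i) : D (j i b) = M.innerDerivation (z i) (j i b) :=
    (DFunLike.congr_fun (hz i) b).symm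
  have e_mul (i) (b : B i) : e i * j i b = j i b := by rw [← hj, (hu i b).1]
  have mul_e (i) (b : B i) : j i b * e i = j i b := by rw [← hj, (hu i b).2]
  have left_right_z (k i) (b : B i) :
      M.left (e k) (M.right (j i b) (z k)) = M.left (e k) (M.right (j i b) (z i)) := by
    rcases eq_or_ne k i with rfl | hki
    · rfl
    · exact hD.left_right_eq_of_mul_eq_zero (hjk k i hki _ _) (hDj k _) (hDj i b)
  let w := ∑ k, M.right (e k) (z k)
  let Z := ∑ k, M.left (e k) (z k) + (w - ∑ k, M.left (e k) w)
  have left_sum (i) (b : B i) (x : ι → X) :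
      ∑ k, M.left (j i b) (M.left (e k) (x k)) = M.left (j i b) (x i) := by
    rw [Finset.sum_eq_single i (fun k _ hk => ?_) (by simp), ← M.left_mul, mul_e]
    rw [← M.left_mul, hjk i k hk.symm, map_zero, zero_apply]
  have right_w (i) (b : B i) : M.right (j i b) w = M.right (j i b) (z i) := by
    rw [map_sum, Finset.sum_eq_single i (fun k _ hk => ?_) (by simp), ← M.right_mul, e_mul]
    rw [← M.right_mul, hjk k i hk, map_zero, zero_apply]
  have left_Z (i) (b : B i) : M.left (j i b) Z = M.left (j i b) (z i) := by
    simp only [Z, map_add, map_sub, map_sum, left_sum, sub_self, add_zero]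
  have right_Z (i) (b : B i) : M.right (j i b) Z = M.right (j i b) (z i) := by
    simp only [Z, map_add, map_sub, map_sum (M.right _), ← M.left_right, left_right_z, right_w]
    abel
  refine ⟨Z, ContinuousLinearMap.ext fun a => ?_⟩
  obtain ⟨b, rfl⟩ := hsum a
  rw [map_sum, map_sum]
  exact Finset.sum_congr rfl fun i _ => by
    rw [hDj, M.innerDerivation_apply, M.innerDerivation_apply, left_Z, right_Z]

end DirectSum

section Contractible

variable {A : Type u} [NonUnitalNormedRing A] [NormedSpace ℂ A]
  {X : Type w} [NormedAddCommGroup X] [NormedSpace ℂ X]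
  {Y : Type v} [NormedAddCommGroup Y] [NormedSpace ℂ Y]

namespace BanachBimodule

/-- The extension of `N` by `M` on `X × Y` determined by a cocycle `c` for the right actions:
`a · (x, y) = (a · x, a · y)` and `(x, y) · a = (x · a + c a y, y · a)`. -/
noncomputable def extension (M : BanachBimodule A X) (N : BanachBimodule A Y)
    (c : A →L[ℂ] Y →L[ℂ] X)
    (hmul : ∀ a b y, c (a * b) y = M.right b (c a y) + c b (N.right a y))
    (hleft : ∀ a b y, M.left a (c b y) = c b (N.left a y)) : BanachBimodule A (X × Y) where
  left := (ContinuousLinearMap.prodMapL ℂ X X Y Y).comp (M.left.prod N.left)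
  right := (ContinuousLinearMap.prodMapL ℂ X X Y Y).comp (M.right.prod N.right)
    + (ContinuousLinearMap.compL ℂ (X × Y) X (X × Y) (.inl ℂ X Y)).comp
      (((ContinuousLinearMap.compL ℂ (X × Y) Y X).flip (.snd ℂ X Y)).comp c)
  left_mul a b x := by simp [Prod.map, M.left_mul, N.left_mul]
  right_mul a b x := by
    simp [Prod.map, M.right_mul, N.right_mul, hmul, add_assoc]
  left_right a b x := by simp [Prod.map, M.left_right, N.left_right, hleft]

theorem extension_right_apply (M : BanachBimodule A X) (N : BanachBimodule A Y)
    (c : A →L[ℂ] Y →L[ℂ] X) (hmul hleft) (a : A) (p : X × Y) :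
    (extension M N c hmul hleft).right a p = (M.right a p.1 + c a p.2, N.right a p.2) := by
  simp [extension, Prod.map]

/-- The unital extension `(a + λ e) · x = a · x + λ x` of the left action to `A₊`. -/
noncomputable def leftPlus (M : BanachBimodule A X) : Aplus A →L[ℂ] X →L[ℂ] X :=
  LinearMap.mkContinuous
    { toFun := fun p => M.left (WithLp.ofLp p).snd
        + (WithLp.ofLp p).fst • ContinuousLinearMap.id ℂ X
      map_add' := fun p q => by simp [add_smul]; abel
      map_smul' := fun c p => by simp [smul_smul] } (‖M.left‖ + 1) fun p => by
    have hid := ContinuousLinearMap.norm_id_le (𝕜 := ℂ) (E := X)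
    change ‖M.left _ + (WithLp.ofLp p).fst • ContinuousLinearMap.id ℂ X‖ ≤ _
    calc
      _ ≤ ‖M.left‖ * ‖(WithLp.ofLp p).snd‖ + ‖(WithLp.ofLp p).fst‖ * 1 := by
        refine norm_add_le_of_le (M.left.le_opNorm _) ?_
        rw [norm_smul]
        gcongr
      _ ≤ (‖M.left‖ + 1) * ‖p‖ := by
        rw [WithLp.unitization_norm_def]
        nlinarith [norm_nonneg M.left, norm_nonneg (WithLp.ofLp p).fst,
          norm_nonneg (WithLp.ofLp p).snd, mul_nonneg (norm_nonneg M.left)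
            (norm_nonneg (WithLp.ofLp p).fst)]

variable [IsScalarTower ℂ A A] [SMulCommClass ℂ A A]

theorem leftPlus_one (M : BanachBimodule A X) : M.leftPlus 1 = ContinuousLinearMap.id ℂ X := by
  change M.left 0 + (1 : ℂ) • ContinuousLinearMap.id ℂ X = _
  rw [map_zero, zero_add, one_smul]

theorem leftPlus_inclPlus (M : BanachBimodule A X) (a : A) :
    M.leftPlus (inclPlus A a) = M.left a := by
  change M.left a + (0 : ℂ) • ContinuousLinearMap.id ℂ X = _
  rw [zero_smul, add_zero]

end BanachBimodule

variable [IsScalarTower ℂ A A] [SMulCommClass ℂ A A]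

theorem exists_eq_inclPlus_add (p : Aplus A) :
    ∃ (a : A) (c : ℂ), p = inclPlus A a + c • (1 : Aplus A) := by
  refine ⟨(WithLp.ofLp p).snd, (WithLp.ofLp p).fst, ?_⟩
  apply (WithLp.equiv 1 (Unitization ℂ A)).injective
  apply Unitization.ext
  · exact (zero_add _).trans (mul_one _) |>.symm
  · exact ((congrArg _ (smul_zero _)).trans (add_zero _)).symm

namespace BanachBimodule

theorem IsMorphism.map_leftPlus {M : BanachBimodule A X} {N : BanachBimodule A Y} {φ : X →L[ℂ] Y}
    (hφ : M.IsMorphism N φ) (p : Aplus A) (x : X) : φ (M.leftPlus p x) = N.leftPlus p (φ x) := by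
  obtain ⟨a, c, rfl⟩ := exists_eq_inclPlus_add p
  simp [leftPlus_inclPlus, leftPlus_one, hφ.1]

theorem leftPlus_right (M : BanachBimodule A X) (p : Aplus A) (a : A) (x : X) :
    M.leftPlus p (M.right a x) = M.right a (M.leftPlus p x) := by
  obtain ⟨b, c, rfl⟩ := exists_eq_inclPlus_add p
  simp [leftPlus_inclPlus, leftPlus_one, M.left_right]

theorem leftPlus_inclPlus_mul (M : BanachBimodule A X) (a : A) (p : Aplus A) (x : X) :
    M.leftPlus (inclPlus A a * p) x = M.left a (M.leftPlus p x) := by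
  obtain ⟨b, c, rfl⟩ := exists_eq_inclPlus_add p
  simp [mul_add, ← inclPlus_mul, leftPlus_inclPlus, leftPlus_one, M.left_mul]

theorem leftPlus_mul_inclPlus (M : BanachBimodule A X) (p : Aplus A) (a : A) (x : X) :
    M.leftPlus (p * inclPlus A a) x = M.leftPlus p (M.left a x) := by
  obtain ⟨b, c, rfl⟩ := exists_eq_inclPlus_add p
  simp [add_mul, ← inclPlus_mul, leftPlus_inclPlus, leftPlus_one, M.left_mul]

theorem leftPlus_plusBimodule_one (p : Aplus A) : (plusBimodule A).leftPlus p 1 = p := by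
  obtain ⟨a, c, rfl⟩ := exists_eq_inclPlus_add p
  simp [leftPlus_inclPlus, leftPlus_one, plusBimodule_left]

theorem isMorphism_leftPlus_flip (M : BanachBimodule A X) {y : X}
    (hy : ∀ a, M.left a y = M.right a y) : (plusBimodule A).IsMorphism M (M.leftPlus.flip y) :=
  ⟨fun a p => by simp [plusBimodule_left, leftPlus_inclPlus_mul],
    fun a p => by simp [plusBimodule_right, leftPlus_mul_inclPlus, hy, leftPlus_right]⟩

end BanachBimodule

/-- A derivation `D` twists the right action of `X × A₊` to `(x, p) · a = (x · a + p · D a, p a)`;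
a morphism splitting the projection onto `A₊` maps `e` to `(z, e)`, where `z` implements `D`. -/
theorem IsContractible.derivationsAreInner [CompleteSpace A] (h : IsContractible A) :
    DerivationsAreInner.{u, u} A := by
  intro X _ _ _ M D hD
  let N := M.extension (plusBimodule A) (M.leftPlus.flip.comp D)
    (fun a b p => by simp [hD a b, plusBimodule_right, M.leftPlus_mul_inclPlus, M.leftPlus_right,
      add_comm])
    (fun a b p => by simp [plusBimodule_left, M.leftPlus_inclPlus_mul])
  have hN (a : A) (p : X × Aplus A) : N.right a p =
      (M.right a p.1 + M.leftPlus p.2 (D a), (plusBimodule A).right a p.2) :=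
    M.extension_right_apply _ _ _ _ a p
  obtain ⟨ψ, ⟨hl, hr⟩, hψ⟩ := h (X × Aplus A) N (.snd ℂ X (Aplus A))
    ⟨fun a p => rfl, fun a p => congrArg Prod.snd (hN a p)⟩
    ⟨.inr ℂ X (Aplus A), ContinuousLinearMap.snd_comp_inr⟩
  have hψ1 : (ψ 1).2 = 1 := DFunLike.congr_fun hψ 1
  refine ⟨(ψ 1).1, ContinuousLinearMap.ext fun a => ?_⟩
  have hcomm : N.left a (ψ 1) = N.right a (ψ 1) := by
    rw [← hl, ← hr, plusBimodule_left, plusBimodule_right, one_mul, mul_one]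
  have hfst : M.left a (ψ 1).1 = M.right a (ψ 1).1 + D a := calc
    _ = (N.left a (ψ 1)).1 := rfl
    _ = (M.right a (ψ 1).1 + M.leftPlus (ψ 1).2 (D a)) := by rw [hcomm, hN]
    _ = _ := by rw [hψ1, M.leftPlus_one, ContinuousLinearMap.id_apply]
  rw [M.innerDerivation_apply, hfst, add_sub_cancel_left]

/-- A bounded section `σ` of `φ : Y → A₊` makes `a ↦ a · σ e - σ e · a` a derivation into `ker φ`;
if `z ∈ ker φ` implements it, then `σ e - z` is a central preimage of `e`. -/
theorem DerivationsAreInner.isContractible (h : DerivationsAreInner.{u, u} A) :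
    IsContractible A := by
  intro Y _ _ _ N φ hφ ⟨σ, hσ⟩
  have hσ1 : φ (σ 1) = 1 := DFunLike.congr_fun hσ 1
  obtain ⟨z, hz, hD⟩ := h.exists_mem_ker hφ (N.isDerivation_innerDerivation (σ 1)) <| by
    ext a : 1
    simp [N.innerDerivation_apply, hφ.1, hφ.2, hσ1, plusBimodule_left, plusBimodule_right]
  have hcentral (a : A) : N.left a (σ 1 - z) = N.right a (σ 1 - z) := by
    have hza := DFunLike.congr_fun hD a
    rw [N.innerDerivation_apply, N.innerDerivation_apply] at hza
    rw [map_sub, map_sub, sub_eq_sub_iff_sub_eq_sub, hza]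
  refine ⟨N.leftPlus.flip (σ 1 - z), N.isMorphism_leftPlus_flip hcentral,
    ContinuousLinearMap.ext fun p => ?_⟩
  rw [ContinuousLinearMap.comp_apply, ContinuousLinearMap.flip_apply, hφ.map_leftPlus, map_sub,
    hσ1, hz, sub_zero, BanachBimodule.leftPlus_plusBimodule_one, ContinuousLinearMap.id_apply]

end Contractible

section Cohomology

variable {A : Type u} [NonUnitalNormedRing A] [NormedSpace ℂ A]
  [IsScalarTower ℂ A A] [SMulCommClass ℂ A A]
  {X : Type w} [NormedAddCommGroup X] [NormedSpace ℂ X]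

theorem coboundary_apply (M : BanachBimodule A X) (n : ℕ)
    (f : ContinuousMultilinearMap ℂ (fun _ : Fin n => A) X) (a : Fin (n + 1) → A) :
    coboundary M n f a =
      M.left (a 0) (f fun i => a i.succ)
        + ∑ j : Fin n, (-1 : ℂ) ^ ((j : ℕ) + 1) • f (Fin.contractNth j.castSucc (· * ·) a)
        + (-1 : ℂ) ^ (n + 1) • M.right (a (Fin.last n)) (f fun i => a i.castSucc) :=
  coboundaryFun_apply M n f a

theorem coboundary_zero_apply (M : BanachBimodule A X)
    (g : ContinuousMultilinearMap ℂ (fun _ : Fin 0 => A) X) (a : Fin 1 → A) :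
    coboundary M 0 g a = M.innerDerivation (g 0) (a 0) := by
  have hg (m : Fin 0 → A) : g m = g 0 := congrArg g (Subsingleton.elim _ _)
  simp [coboundary_apply, hg, sub_eq_add_neg, M.innerDerivation_apply]

theorem coboundary_one_apply (M : BanachBimodule A X)
    (g : ContinuousMultilinearMap ℂ (fun _ : Fin 1 => A) X) (a : Fin 2 → A) :
    coboundary M 1 g a =
      M.left (a 0) (g fun _ => a 1) - g (fun _ => a 0 * a 1) + M.right (a 1) (g fun _ => a 0) := by
  have const_zero (m : Fin 1 → A) : m = fun _ => m 0 := funext fun i => by rw [Fin.eq_zero i]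
  rw [coboundary_apply, Fin.sum_univ_one, const_zero fun i => a i.succ,
    const_zero fun i => a i.castSucc, const_zero (Fin.contractNth _ _ _),
    Fin.contractNth_apply_of_eq _ _ _ _ rfl]
  simp [sub_eq_add_neg]

theorem subsingleton_hochschildCohomology_succ_iff (M : BanachBimodule A X) (n : ℕ) :
    Subsingleton (HochschildCohomology M (n + 1)) ↔
      ∀ f, coboundary M (n + 1) f = 0 → ∃ g, coboundary M n g = f := by
  rw [Submodule.Quotient.subsingleton_iff, Submodule.eq_top_iff']
  simp only [Subtype.forall, LinearMap.mem_ker, Submodule.mem_comap, Submodule.subtype_apply]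
  rfl

theorem coboundary_one_ofSubsingleton_eq_zero_iff (M : BanachBimodule A X) (D : A →L[ℂ] X) :
    coboundary M 1 (ContinuousMultilinearMap.ofSubsingleton ℂ A X (0 : Fin 1) D) = 0 ↔
      M.IsDerivation D := by
  have hδ (a : Fin 2 → A) :
      coboundary M 1 (ContinuousMultilinearMap.ofSubsingleton ℂ A X (0 : Fin 1) D) a =
        M.left (a 0) (D (a 1)) + M.right (a 1) (D (a 0)) - D (a 0 * a 1) := by
    rw [coboundary_one_apply, sub_add_eq_add_sub]
    rfl
  constructor
  · intro h a b
    have hab := (hδ ![a, b]).symm.trans (DFunLike.congr_fun h ![a, b])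
    exact (sub_eq_zero.1 hab).symm
  · exact fun hD => ContinuousMultilinearMap.ext fun a => by
      rw [hδ, hD, sub_self, zero_apply]

theorem coboundary_zero_eq_ofSubsingleton_iff (M : BanachBimodule A X)
    (g : ContinuousMultilinearMap ℂ (fun _ : Fin 0 => A) X) (D : A →L[ℂ] X) :
    coboundary M 0 g = ContinuousMultilinearMap.ofSubsingleton ℂ A X (0 : Fin 1) D ↔
      M.innerDerivation (g 0) = D := by
  constructor
  · intro h
    ext a
    exact (coboundary_zero_apply M g fun _ => a).symm.trans (DFunLike.congr_fun h fun _ => a)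
  · rintro rfl
    ext a
    exact coboundary_zero_apply M g a

theorem subsingleton_hochschildCohomology_one_iff (M : BanachBimodule A X) :
    Subsingleton (HochschildCohomology M 1) ↔
      ∀ D : A →L[ℂ] X, M.IsDerivation D → ∃ z, M.innerDerivation z = D := by
  rw [subsingleton_hochschildCohomology_succ_iff,
    ← (ContinuousMultilinearMap.ofSubsingleton ℂ A X (0 : Fin 1)).forall_congr_right]
  refine forall_congr' fun D => imp_congr (coboundary_one_ofSubsingleton_eq_zero_iff M D) ?_
  simp only [coboundary_zero_eq_ofSubsingleton_iff]
  exact ⟨fun ⟨g, hg⟩ => ⟨g 0, hg⟩,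
    fun ⟨z, hz⟩ => ⟨ContinuousMultilinearMap.constOfIsEmpty ℂ (fun _ : Fin 0 => A) z, hz⟩⟩

/-- The bimodule of bounded linear maps `T : A → X` with actions `(a · T) b = a · T b` and
`(T · a) b = T (a b) - T a · b`. The asymmetry makes
`Cⁿ(A, X) ≃ Cⁿ⁻¹(A, A →L[ℂ] X)` compatible with the coboundary operators. -/
noncomputable def homBimodule (M : BanachBimodule A X) : BanachBimodule A (A →L[ℂ] X) where
  left := (ContinuousLinearMap.compL ℂ A X X).comp M.left
  right := (ContinuousLinearMap.compL ℂ A A X).flip.comp (ContinuousLinearMap.mul ℂ A)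
    - (ContinuousLinearMap.compL ℂ (A →L[ℂ] X) X (A →L[ℂ] X) M.right.flip).comp
      (ContinuousLinearMap.apply ℂ X)
  left_mul a b T := by ext; simp [M.left_mul]
  right_mul a b T := by ext; simp [M.right_mul, mul_assoc]
  left_right a b T := by ext; simp [M.left_right]

theorem homBimodule_left_apply (M : BanachBimodule A X) (a b : A) (T : A →L[ℂ] X) :
    (homBimodule M).left a T b = M.left a (T b) := rfl

theorem homBimodule_right_apply (M : BanachBimodule A X) (a b : A) (T : A →L[ℂ] X) :
    (homBimodule M).right a T b = T (a * b) - M.right b (T a) := rfl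

theorem init_contractNth_castSucc {α : Type*} {n : ℕ} (op : α → α → α) (j : Fin n)
    (a : Fin (n + 2) → α) :
    (Fin.init (Fin.contractNth j.castSucc.castSucc op a) : Fin n → α) =
      Fin.contractNth j.castSucc op (Fin.init a) := rfl

theorem init_contractNth_last {α : Type*} {n : ℕ} (op : α → α → α) (a : Fin (n + 2) → α) :
    (Fin.init (Fin.contractNth (Fin.last n).castSucc op a) : Fin n → α) =
      fun i => a i.castSucc.castSucc :=
  funext fun i => Fin.contractNth_apply_of_lt _ _ _ _ (by simp)

theorem contractNth_castSucc_last {α : Type*} {n : ℕ} (op : α → α → α) (j : Fin n)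
    (a : Fin (n + 2) → α) :
    Fin.contractNth j.castSucc.castSucc op a (Fin.last n) = a (Fin.last (n + 1)) :=
  Fin.contractNth_apply_of_gt _ _ _ _ (by simp)

theorem contractNth_last_last {α : Type*} {n : ℕ} (op : α → α → α) (a : Fin (n + 2) → α) :
    Fin.contractNth (Fin.last n).castSucc op a (Fin.last n) =
      op (a (Fin.last n).castSucc) (a (Fin.last (n + 1))) :=
  Fin.contractNth_apply_of_eq _ _ _ _ rfl

theorem uncurryRight_coboundary (M : BanachBimodule A X) (n : ℕ)
    (g : ContinuousMultilinearMap ℂ (fun _ : Fin n => A) (A →L[ℂ] X)) :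
    ContinuousMultilinearMap.uncurryRight (Ei := fun _ : Fin (n + 2) => A)
        (coboundary (homBimodule M) n g) =
      coboundary M (n + 1)
        (ContinuousMultilinearMap.uncurryRight (Ei := fun _ : Fin (n + 1) => A) g) := by
  ext a
  rw [ContinuousMultilinearMap.uncurryRight_apply, coboundary_apply, coboundary_apply,
    Fin.sum_univ_castSucc, pow_succ _ (n + 1)]
  simp only [_root_.add_apply, _root_.sum_apply, _root_.smul_apply, homBimodule_left_apply,
    homBimodule_right_apply, ContinuousMultilinearMap.uncurryRight_apply,
    init_contractNth_castSucc, init_contractNth_last, contractNth_castSucc_last,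
    contractNth_last_last, Fin.val_castSucc, Fin.val_last, smul_sub, mul_neg, mul_one, neg_smul]
  exact (fun p q r s => by abel : ∀ p q r s : X, p + q + (r - s) = p + (q + r) + -s) _ _ _ _

theorem subsingleton_hochschildCohomology_of_homBimodule (M : BanachBimodule A X) (n : ℕ)
    (h : Subsingleton (HochschildCohomology (homBimodule M) (n + 1))) :
    Subsingleton (HochschildCohomology M (n + 2)) := by
  refine (subsingleton_hochschildCohomology_succ_iff M _).2 fun f hf => ?_
  have hcurry : coboundary (homBimodule M) (n + 1) f.curryRight = 0 := by
    rw [← ContinuousMultilinearMap.curry_uncurryRight (Ei := fun _ : Fin (n + 3) => A)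
      (coboundary (homBimodule M) (n + 1) f.curryRight), uncurryRight_coboundary,
      ContinuousMultilinearMap.uncurry_curryRight, hf]
    rfl
  obtain ⟨g, hg⟩ := (subsingleton_hochschildCohomology_succ_iff _ n).1 h _ hcurry
  exact ⟨ContinuousMultilinearMap.uncurryRight (Ei := fun _ : Fin (n + 1) => A) g, by
    rw [← uncurryRight_coboundary, hg, ContinuousMultilinearMap.uncurry_curryRight]⟩

theorem DerivationsAreInner.subsingleton_hochschildCohomology
    (h : DerivationsAreInner.{u, max u w} A) (n : ℕ) :
    ∀ (X : Type max u w) [NormedAddCommGroup X] [NormedSpace ℂ X] [CompleteSpace X]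
      (M : BanachBimodule A X), Subsingleton (HochschildCohomology M (n + 1)) := by
  induction n with
  | zero => exact fun X _ _ _ M => (subsingleton_hochschildCohomology_one_iff M).2 (h X M)
  | succ n ih =>
    exact fun X _ _ _ M => subsingleton_hochschildCohomology_of_homBimodule M n (ih _ _)

end Cohomology

theorem one_le_norm_of_eq_mul_right {R : Type*} [NonUnitalNormedRing R] {a z : R} (ha : a ≠ 0)
    (h : a = a * z) : 1 ≤ ‖z‖ :=
  (le_mul_iff_one_le_right (norm_pos_iff.2 ha)).1 ((congrArg norm h).trans_le (norm_mul_le a z))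

theorem one_le_norm_of_eq_mul_left {R : Type*} [NonUnitalNormedRing R] {a z : R} (ha : a ≠ 0)
    (h : a = z * a) : 1 ≤ ‖z‖ :=
  (le_mul_iff_one_le_left (norm_pos_iff.2 ha)).1 ((congrArg norm h).trans_le (norm_mul_le z a))

namespace ContinuousField

variable {Ω : Type u} [TopologicalSpace Ω] {A : Ω → Type v}
  [∀ t, NonUnitalNormedRing (A t)] [∀ t, NormedSpace ℂ (A t)]

theorem exists_mem_ne_zero (𝒰 : ContinuousField Ω A) (t : Ω) [Nontrivial (A t)] :
    ∃ x ∈ 𝒰.Θ, x t ≠ 0 := by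
  obtain ⟨a, ha⟩ := exists_ne (0 : A t)
  obtain ⟨_, h0, x, hx, rfl⟩ := (𝒰.dense_eval t).inter_open_nonempty {0}ᶜ
    isOpen_compl_singleton ⟨a, ha⟩
  exact ⟨x, hx, h0⟩

theorem smul_mem (𝒰 : ContinuousField Ω A) {f : Ω → ℂ} (hf : Continuous f) {x : ∀ t, A t}
    (hx : x ∈ 𝒰.Θ) : (fun t => f t • x t) ∈ 𝒰.Θ := by
  refine 𝒰.mem_of_locally_approx _ fun t ε hε => ⟨f t • x, 𝒰.Θ.smul_mem' _ hx, ?_⟩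
  have h : Continuous fun s => ‖f s - f t‖ * ‖x s‖ :=
    (hf.sub continuous_const).norm.mul (𝒰.continuous_norm x hx)
  have h0 : Tendsto (fun s => ‖f s - f t‖ * ‖x s‖) (𝓝 t) (𝓝 0) := by
    simpa using h.tendsto t
  filter_upwards [h0.eventually (gt_mem_nhds hε)] with s hs
  rw [Pi.smul_apply, ← sub_smul]
  exact (norm_smul_le _ _).trans hs.le

/-- Evaluation of sections at the point `t`. -/
noncomputable def eval (𝒰 : ContinuousField Ω A) (t : Ω) : 𝒰.sectionAlgebra →L[ℂ] A t :=
  LinearMap.mkContinuous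
    { toFun := fun a => (a : lp A ∞) t
      map_add' := fun _ _ => rfl
      map_smul' := fun _ _ => rfl } 1 fun a => by
    rw [one_mul]
    exact lp.norm_apply_le_norm ENNReal.top_ne_zero (a : lp A ∞) t

theorem eval_mul (𝒰 : ContinuousField Ω A) (t : Ω) (a b : 𝒰.sectionAlgebra) :
    𝒰.eval t (a * b) = 𝒰.eval t a * 𝒰.eval t b := rfl

theorem norm_eval_le (𝒰 : ContinuousField Ω A) (t : Ω) (a : 𝒰.sectionAlgebra) :
    ‖𝒰.eval t a‖ ≤ ‖a‖ :=
  lp.norm_apply_le_norm ENNReal.top_ne_zero (a : lp A ∞) t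

theorem eval_ext (𝒰 : ContinuousField Ω A) {a b : 𝒰.sectionAlgebra}
    (h : ∀ t, 𝒰.eval t a = 𝒰.eval t b) : a = b :=
  Subtype.ext (lp.ext (funext h))

theorem exists_eval_eq_of_notMem [T2Space Ω] [LocallyCompactSpace Ω] (𝒰 : ContinuousField Ω A)
    {x : ∀ t, A t} (hx : x ∈ 𝒰.Θ) {C : Set Ω} (hC : IsClosed C) {s : Ω} (hs : s ∉ C) :
    ∃ a, 𝒰.eval s a = x s ∧ ∀ t ∈ C, 𝒰.eval t a = 0 := by
  obtain ⟨f, hf1, hf0, hfc, -⟩ := exists_continuous_one_zero_of_isCompact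
    (isCompact_singleton (x := s)) hC (Set.disjoint_singleton_left.2 hs)
  have hvanish : Tendsto (fun t => ‖(f t : ℂ) • x t‖) (cocompact Ω) (𝓝 0) := by
    refine tendsto_const_nhds.congr' ?_
    filter_upwards [hfc.isCompact.compl_mem_cocompact] with t ht
    rw [image_eq_zero_of_notMem_tsupport ht, Complex.ofReal_zero, zero_smul, norm_zero]
  obtain ⟨a, ha⟩ := 𝒰.exists_section
    (𝒰.smul_mem (Complex.continuous_ofReal.comp f.continuous) hx) hvanish
  refine ⟨a, (ha s).trans ?_, fun t ht => (ha t).trans ?_⟩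
  · simp [hf1 (Set.mem_singleton s)]
  · simp [hf0 ht]

theorem exists_eval_ne_zero_of_notMem [T2Space Ω] [LocallyCompactSpace Ω]
    (𝒰 : ContinuousField Ω A) {C : Set Ω} (hC : IsClosed C) {s : Ω} [Nontrivial (A s)]
    (hs : s ∉ C) : ∃ a, 𝒰.eval s a ≠ 0 ∧ ∀ t ∈ C, 𝒰.eval t a = 0 := by
  obtain ⟨x, hx, hxs⟩ := 𝒰.exists_mem_ne_zero s
  obtain ⟨a, has, haC⟩ := 𝒰.exists_eval_eq_of_notMem hx hC hs
  exact ⟨a, has.trans_ne hxs, haC⟩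

theorem denseRange_eval [T2Space Ω] [LocallyCompactSpace Ω] (𝒰 : ContinuousField Ω A) (t : Ω) :
    DenseRange (𝒰.eval t) := by
  refine (𝒰.dense_eval t).mono ?_
  rintro _ ⟨x, hx, rfl⟩
  obtain ⟨a, ha, -⟩ := 𝒰.exists_eval_eq_of_notMem hx isClosed_empty (Set.notMem_empty t)
  exact ⟨a, ha⟩

theorem compactSpace_of_left_unit [T2Space Ω] [LocallyCompactSpace Ω] [∀ t, Nontrivial (A t)]
    (𝒰 : ContinuousField Ω A) {e : 𝒰.sectionAlgebra} (he : ∀ a, e * a = a) :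
    CompactSpace Ω := by
  have one_le_norm (t : Ω) : 1 ≤ ‖𝒰.eval t e‖ := by
    obtain ⟨a, ha, -⟩ := 𝒰.exists_eval_ne_zero_of_notMem isClosed_empty (Set.notMem_empty t)
    exact one_le_norm_of_eq_mul_left ha (by rw [← eval_mul, he])
  obtain ⟨K, hK, hKs⟩ := mem_cocompact.1 (e.2.2.eventually (gt_mem_nhds one_pos))
  have hKu : K = Set.univ := Set.eq_univ_of_forall fun t =>
    not_imp_comm.1 (@hKs t) (not_lt.2 (one_le_norm t))
  exact ⟨hKu ▸ hK⟩

/-- An isometric multiplicative embedding, over `Y`, of the field `𝒰` into the trivial field with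
fibre `B`, taking continuous vector fields to continuous functions. The embeddings of the fibres
need not be onto. -/
structure TrivialEmbedding (𝒰 : ContinuousField Ω A) (Y : Set Ω) (B : Type w)
    [NonUnitalNormedRing B] [NormedSpace ℂ B] where
  toFun : ∀ t : Y, A t →ₗᵢ[ℂ] B
  map_mul : ∀ (t : Y) (a b : A t), toFun t (a * b) = toFun t a * toFun t b
  continuous_apply : ∀ x ∈ 𝒰.Θ, Continuous fun t : Y => toFun t (x t)

/-- Every point has a neighbourhood over which the field embeds isometrically into a trivial
field. -/
def IsLocallySubtrivial (𝒰 : ContinuousField Ω A) : Prop :=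
  ∀ t : Ω, ∃ V ∈ 𝓝 t, ∃ (B : Type v) (_ : NonUnitalNormedRing B) (_ : NormedSpace ℂ B)
    (_ : IsScalarTower ℂ B B) (_ : SMulCommClass ℂ B B) (_ : CompleteSpace B),
    Nonempty (𝒰.TrivialEmbedding V B)

theorem IsLocallyTrivial.isLocallySubtrivial {𝒰 : ContinuousField Ω A}
    (h : 𝒰.IsLocallyTrivial) : 𝒰.IsLocallySubtrivial := by
  intro t
  obtain ⟨V, hV, B, hB, hB₁, hB₂, hB₃, hB₄, φ, hφ, hφc⟩ := h t
  exact ⟨V, hV, B, hB, hB₁, hB₂, hB₃, hB₄, ⟨{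
    toFun := fun t => (φ t).toLinearIsometry
    map_mul := hφ
    continuous_apply := fun x hx => (hφc fun t => x t).1 fun t ε hε =>
      ⟨x, hx, Eventually.of_forall fun s => by simpa using hε.le⟩ }⟩⟩

namespace TrivialEmbedding

open scoped BoundedContinuousFunction

variable {𝒰 : ContinuousField Ω A} {Y : Set Ω} {B : Type w} [NonUnitalNormedRing B]
  [NormedSpace ℂ B] {Z : Type*} [TopologicalSpace Z]

/-- The homomorphism `a ↦ φ ∘ a ∘ g` from the section algebra to the bounded continuous functions
on `Z` induced by a continuous map `g : Z → Y` and an embedding `φ` over `Y`. -/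
noncomputable def pullbackHom (φ : 𝒰.TrivialEmbedding Y B) (g : C(Z, Y)) :
    𝒰.sectionAlgebra →L[ℂ] Z →ᵇ B :=
  LinearMap.mkContinuous
    { toFun := fun a => .ofNormedAddCommGroup (fun s => φ.toFun (g s) (𝒰.eval (g s) a))
        ((φ.continuous_apply _ a.2.1).comp g.continuous) ‖a‖ fun s =>
          ((φ.toFun (g s)).norm_map _).trans_le (𝒰.norm_eval_le (g s) a)
      map_add' := fun _ _ => BoundedContinuousFunction.ext fun s => map_add (φ.toFun (g s)) _ _
      map_smul' := fun _ _ => BoundedContinuousFunction.ext fun s => map_smul (φ.toFun (g s)) _ _ }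
    1 fun a => by
    rw [one_mul]
    exact (BoundedContinuousFunction.norm_le (norm_nonneg a)).2 fun s =>
      ((φ.toFun (g s)).norm_map _).trans_le (𝒰.norm_eval_le (g s) a)

theorem pullbackHom_mul (φ : 𝒰.TrivialEmbedding Y B) (g : C(Z, Y)) (a b : 𝒰.sectionAlgebra) :
    φ.pullbackHom g (a * b) = φ.pullbackHom g a * φ.pullbackHom g b :=
  BoundedContinuousFunction.ext fun s => φ.map_mul (g s) _ _

/-- Intertwining `a ↦ φ ∘ a` with `a ↦ φ (a t₀)` gives `φ (a s) = φ (a s) * z s` for each section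
`a` with `a t₀ = 0`. -/
theorem exists_one_le_norm_apply [T2Space Ω] [LocallyCompactSpace Ω] [∀ t, Nontrivial (A t)]
    [IsScalarTower ℂ B B] [SMulCommClass ℂ B B] [CompleteSpace B] (φ : 𝒰.TrivialEmbedding Y B)
    (h : DerivationsAreInner.{max u v, max u w} 𝒰.sectionAlgebra) (t₀ : Y) :
    ∃ z : Y →ᵇ B, z t₀ = 0 ∧ ∀ s ≠ t₀, 1 ≤ ‖z s‖ := by
  obtain ⟨z, hz, hpq⟩ := h.exists_intertwiner (φ.pullbackHom_mul (ContinuousMap.id Y))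
    (φ.pullbackHom_mul (ContinuousMap.const Y t₀))
    (ρ := BoundedContinuousFunction.evalCLM ℂ t₀) (fun _ _ => rfl) rfl
  refine ⟨z, hz, fun s hs => ?_⟩
  obtain ⟨a, has, hat⟩ := 𝒰.exists_eval_ne_zero_of_notMem (isClosed_singleton (x := (t₀ : Ω)))
    (s := s) (fun hst => hs (Subtype.ext hst))
  have hφt : φ.toFun t₀ (𝒰.eval t₀ a) = 0 := by rw [hat _ rfl, map_zero]
  have hφs : φ.toFun s (𝒰.eval s a) ≠ 0 := (map_ne_zero_iff _ (φ.toFun s).injective).2 has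
  have hzs : φ.toFun s (𝒰.eval s a) - φ.toFun t₀ (𝒰.eval t₀ a) =
      φ.toFun s (𝒰.eval s a) * z s - z s * φ.toFun t₀ (𝒰.eval t₀ a) := DFunLike.congr_fun (hpq a) s
  rw [hφt, mul_zero, sub_zero, sub_zero] at hzs
  exact one_le_norm_of_eq_mul_right hφs hzs

theorem singleton_mem_nhds [T2Space Ω] [LocallyCompactSpace Ω] [∀ t, Nontrivial (A t)]
    [IsScalarTower ℂ B B] [SMulCommClass ℂ B B] [CompleteSpace B] (φ : 𝒰.TrivialEmbedding Y B)
    (h : DerivationsAreInner.{max u v, max u w} 𝒰.sectionAlgebra) {t₀ : Ω} (hY : Y ∈ 𝓝 t₀) :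
    {t₀} ∈ 𝓝 t₀ := by
  let k₀ : Y := ⟨t₀, mem_of_mem_nhds hY⟩
  obtain ⟨z, hz, hone⟩ := φ.exists_one_le_norm_apply h k₀
  have hlt : ∀ᶠ s in 𝓝 k₀, ‖z s‖ < 1 :=
    z.continuous.norm.tendsto k₀ |>.eventually (gt_mem_nhds (by simp [hz]))
  rw [← map_nhds_subtype_coe_eq_nhds (mem_of_mem_nhds hY) hY, mem_map]
  filter_upwards [hlt] with s hs
  exact congrArg Subtype.val (not_imp_comm.1 (hone s) (not_le.2 hs))

end TrivialEmbedding

theorem IsLocallySubtrivial.discreteTopology [T2Space Ω] [LocallyCompactSpace Ω]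
    [∀ t, Nontrivial (A t)] {𝒰 : ContinuousField Ω A} (hloc : 𝒰.IsLocallySubtrivial)
    (h : DerivationsAreInner.{max u v, max u v} 𝒰.sectionAlgebra) : DiscreteTopology Ω := by
  refine discreteTopology_iff_singleton_mem_nhds.2 fun t => ?_
  obtain ⟨V, hV, B, _, _, _, _, _, ⟨φ⟩⟩ := hloc t
  exact φ.singleton_mem_nhds h hV

section Discrete

variable [DiscreteTopology Ω] [DecidableEq Ω]

theorem single_mem_sectionAlgebra (𝒰 : ContinuousField Ω A) (t : Ω) (a : A t) :
    lp.single ∞ t a ∈ 𝒰.sectionAlgebra := by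
  constructor
  · refine 𝒰.mem_of_locally_approx _ fun s ε hε => ?_
    obtain ⟨_, ⟨x, hx, rfl⟩, hxa⟩ :=
      Metric.mem_closure_iff.1 (𝒰.dense_eval s (lp.single ∞ t a s)) ε hε
    refine ⟨x, hx, ?_⟩
    rw [nhds_discrete, eventually_pure, ← dist_eq_norm]
    exact hxa.le
  · refine tendsto_const_nhds.congr' ?_
    rw [cocompact_eq_cofinite]
    filter_upwards [(Set.finite_singleton t).compl_mem_cofinite] with s hs
    rw [lp.single_apply_ne ∞ t a hs, norm_zero]

/-- The section of a field over a discrete space with the single nonzero value `a` at `t`. -/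
noncomputable def single (𝒰 : ContinuousField Ω A) (t : Ω) : A t →L[ℂ] 𝒰.sectionAlgebra :=
  LinearMap.mkContinuous
    { toFun := fun a => ⟨lp.single ∞ t a, 𝒰.single_mem_sectionAlgebra t a⟩
      map_add' := fun a b => Subtype.ext (lp.single_add ∞ t a b)
      map_smul' := fun c a => Subtype.ext (lp.single_smul ∞ t c a) } 1 fun a => by
    rw [one_mul]
    exact (lp.norm_single ENNReal.zero_lt_top t a).le

theorem eval_single (𝒰 : ContinuousField Ω A) (s t : Ω) (a : A t) :
    𝒰.eval s (𝒰.single t a) = Pi.single t a s := rfl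

theorem single_mul (𝒰 : ContinuousField Ω A) (t : Ω) (a b : A t) :
    𝒰.single t (a * b) = 𝒰.single t a * 𝒰.single t b :=
  𝒰.eval_ext fun s => by
    rw [eval_mul, eval_single, eval_single, eval_single, Pi.single_mul, Pi.mul_apply]

theorem single_mul_single_of_ne (𝒰 : ContinuousField Ω A) {s t : Ω} (hst : s ≠ t) (a : A s)
    (b : A t) : 𝒰.single s a * 𝒰.single t b = 0 :=
  𝒰.eval_ext fun r => by
    rw [eval_mul, eval_single, eval_single, map_zero]
    rcases eq_or_ne r s with rfl | hrs
    · rw [Pi.single_eq_of_ne hst, mul_zero]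
    · rw [Pi.single_eq_of_ne hrs, zero_mul]

theorem sum_single_eval [Fintype Ω] (𝒰 : ContinuousField Ω A) (a : 𝒰.sectionAlgebra) :
    ∑ t, 𝒰.single t (𝒰.eval t a) = a :=
  𝒰.eval_ext fun s => by
    simp only [map_sum, eval_single]
    rw [← Finset.sum_apply, Finset.univ_sum_single]

end Discrete

theorem derivationsAreInner_sectionAlgebra [Finite Ω] [DiscreteTopology Ω]
    [∀ t, IsScalarTower ℂ (A t) (A t)] [∀ t, SMulCommClass ℂ (A t) (A t)]
    [∀ t, CompleteSpace (A t)] (𝒰 : ContinuousField Ω A)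
    (h : ∀ t, DerivationsAreInner.{v, v} (A t)) :
    DerivationsAreInner.{max u v, w} 𝒰.sectionAlgebra := by
  classical
  have := Fintype.ofFinite Ω
  exact .of_finite_sum (fun t => (h t).lift_universe) (fun t => (h t).exists_unit) 𝒰.single
    𝒰.single_mul (fun _ _ => 𝒰.single_mul_single_of_ne)
    fun a => ⟨fun t => 𝒰.eval t a, (𝒰.sum_single_eval a).symm⟩

end ContinuousField

end ContFieldAlg

open ContFieldAlg in
theorem theorem5p2_general {Ω : Type u} [TopologicalSpace Ω] [T2Space Ω] [LocallyCompactSpace Ω]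
    {A : Ω → Type v} [∀ t, NonUnitalNormedRing (A t)] [∀ t, NormedSpace ℂ (A t)]
    [∀ t, IsScalarTower ℂ (A t) (A t)] [∀ t, SMulCommClass ℂ (A t) (A t)]
    [∀ t, CompleteSpace (A t)] [∀ t, Nontrivial (A t)]
    (𝒰 : ContinuousField Ω A) (hloc : 𝒰.IsLocallySubtrivial) :
    List.TFAE [
      IsContractible 𝒰.sectionAlgebra,
      Finite Ω ∧ DiscreteTopology Ω ∧ ∀ x : Ω, IsContractible (A x),
      ∀ (X : Type (max u v)) [NormedAddCommGroup X] [NormedSpace ℂ X] [CompleteSpace X]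
        (M : BanachBimodule 𝒰.sectionAlgebra X) (n : ℕ), 1 ≤ n →
          Subsingleton (HochschildCohomology M n)] := by
  tfae_have 1 → 3 := fun h X _ _ _ M n hn => by
    obtain ⟨n, rfl⟩ := Nat.exists_eq_add_of_le' hn
    exact DerivationsAreInner.subsingleton_hochschildCohomology.{max u v, max u v}
      h.derivationsAreInner n X M
  tfae_have 3 → 2 := fun h => by
    have hD : DerivationsAreInner.{max u v, max u v} 𝒰.sectionAlgebra := fun X _ _ _ M =>
      (subsingleton_hochschildCohomology_one_iff M).1 (h X M 1 le_rfl)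
    obtain ⟨e, he⟩ := hD.exists_unit
    have : CompactSpace Ω := 𝒰.compactSpace_of_left_unit fun a => (he a).1
    have : DiscreteTopology Ω := hloc.discreteTopology hD
    exact ⟨finite_of_compact_of_discrete, this, fun t => (hD.lift_universe.of_denseRange
      (𝒰.eval t) (𝒰.eval_mul t) (𝒰.denseRange_eval t)).isContractible⟩
  tfae_have 2 → 1 := fun ⟨_, _, h⟩ =>
    (𝒰.derivationsAreInner_sectionAlgebra fun t => (h t).derivationsAreInner).isContractible
  tfae_finish

theorem theorem5p2 {Ω : Type u} [TopologicalSpace Ω] [T2Space Ω] [LocallyCompactSpace Ω]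
    {A : Ω → Type v} [∀ t, NonUnitalNormedRing (A t)] [∀ t, NormedSpace ℂ (A t)]
    [∀ t, IsScalarTower ℂ (A t) (A t)] [∀ t, SMulCommClass ℂ (A t) (A t)]
    [∀ t, CompleteSpace (A t)] [∀ t, Nontrivial (A t)]
    (𝒰 : ContFieldAlg.ContinuousField Ω A) (hloc : 𝒰.IsLocallyTrivial) :
    List.TFAE [
      ContFieldAlg.IsContractible 𝒰.sectionAlgebra,
      Finite Ω ∧ DiscreteTopology Ω ∧ ∀ x : Ω, ContFieldAlg.IsContractible (A x),
      ∀ (X : Type (max u v)) [NormedAddCommGroup X] [NormedSpace ℂ X] [CompleteSpace X]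
        (M : ContFieldAlg.BanachBimodule 𝒰.sectionAlgebra X) (n : ℕ), 1 ≤ n →
          Subsingleton (ContFieldAlg.HochschildCohomology M n)] :=
  theorem5p2_general 𝒰 hloc.isLocallySubtrivial
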